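/- Let $n, m, p \in \mathbb{N}$, $T_s \in \mathbb{R}$, and let $\hat A \in \mathbb{R}^{n\times n}$, $\hat B \in \mathbb{R}^{n\times m}$, $H \in \mathbb{R}^{n\times p}$, $E \in \mathbb{R}^{p\times n}$, $F \in \mathbb{R}^{p\times m}$. A sampling with maximal interval $T_s$ is a sequence $0 = t_0 < t_1 < t_2 < \cdots$ with $t_k \to \infty$ and $t_{k+1} - t_k \le T_s$ for all $k$; its delay is $\tau(t) = t - t_k$ for $t \in [t_k, t_{k+1})$, so that $\tau(t) \in [0, T_s]$. Suppose there are matrices $Q_1 = Q_1^{\mathsf T} \succ 0$, $Q_2$, $Q_3$, $Z_1$, $Z_2$, $Z_3$, $R = R^{\mathsf T} \succ 0$ in $\mathbb{R}^{n \times n}$, $Y \in \mathbb{R}^{m\times n}$ and scalars $\epsilon_1 > 0$, $\epsilon_2 > 0$ such that the two symmetric block matrices below satisfy (with $*$ denoting the blocks determined by symmetry) $$\begin{bmatrix} \Xi & \Xi_{\hat A,\hat B} & T_s Q_2^{\mathsf T} & 0 & \epsilon_1 (Q_1 E^{\mathsf T} + Y^{\mathsf T} F^{\mathsf T}) \\ *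 & -Q_3 - Q_3^{\mathsf T} + T_s Z_3 & T_s Q_3^{\mathsf T} & H & 0 \\ * & * & -T_s R & 0 & 0 \\ * & * & * & -\epsilon_1 I & 0 \\ * & * & * & * & -\epsilon_1 I \end{bmatrix} \prec 0,$$ $$\begin{bmatrix} 2 Q_1 - R & 0 & Y^{\mathsf T} \hat B^{\mathsf T} & 0 & \epsilon_2 Y^{\mathsf T} F^{\mathsf T} \\ * & Z_1 & Z_2 & 0 & 0 \\ * & * & Z_3 & H & 0 \\ * & * & * & \epsilon_2 I & 0 \\ * & * & * & * & \epsilon_2 I \end{bmatrix} \succeq 0,$$ where $\Xi = Q_2 + Q_2^{\mathsf T} + T_s Z_1$ and $\Xi_{\hat A, \hat B} = Q_3 - Q_2^{\mathsf T} + Q_1 \hat A^{\mathsf T} + T_s Z_2 + Y^{\mathsf T} \hat B^{\mathsf T}$. Let $K = Y Q_1^{-1}$. Then the uncertain sampled-data closed loop $$\dot x(t) = (\hat A + H \Delta E)\, x(t) + (\hat B + H \Delta F) K\, x(t - \tau(t)), \qquad t \ge 0,$$ is robustly asymptotically stable for all samplings with maximal interval $T_s$: for every diagonal $\Delta = \mathrm{Diag}(\delta_1,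 \dots, \delta_p)$ with $|\delta_i| \le 1$ for all $i$ and every such sampling, for each $\epsilon > 0$ there is $\delta > 0$ such that every solution with $\|x(0)\| < \delta$ satisfies $\|x(t)\| < \epsilon$ for all $t \ge 0$, and every solution satisfies $x(t) \to 0$ as $t \to \infty$. -/

import Mathlib

open Set Filter Topology Matrix

namespace SampledData

/-- Admissible sampling instants `0 = t₀ < t₁ < t₂ < ⋯` (exhausting the time axis `[0, ∞)`),
whose consecutive distances are at most `Ts`. -/
structure IsSampling (Ts : ℝ) (t : ℕ → ℝ) : Prop where
  zero : t 0 = 0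
  strictMono : StrictMono t
  tendsto : Tendsto t atTop atTop
  interval_le : ∀ k, t (k + 1) - t k ≤ Ts

/-- `τ` is the delay induced by the sampling instants `t`:
`τ(s) = s - t_k` for `s ∈ [t_k, t_{k+1})`. -/
def IsSamplingDelay (t : ℕ → ℝ) (τ : ℝ → ℝ) : Prop :=
  ∀ k : ℕ, ∀ s ∈ Ico (t k) (t (k + 1)), τ s = s - t k

/-- `x` solves `ẋ(s) = A x(s) + A₁ x(s - τ(s))` on `[0, ∞)`: it is continuous and satisfies the
equation with the derivative from the right. (The right-hand side jumps at the sampling instants;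
between them it is continuous, so there the right derivative is the ordinary derivative.) -/
def IsSolution {n : ℕ} (A A₁ : Matrix (Fin n) (Fin n) ℝ) (τ : ℝ → ℝ)
    (x : ℝ → Fin n → ℝ) : Prop :=
  ContinuousOn x (Ici 0) ∧
    ∀ s : ℝ, 0 ≤ s → HasDerivWithinAt x (A *ᵥ x s + A₁ *ᵥ x (s - τ s)) (Ici s) s

/-- Asymptotic stability of the zero solution of `ẋ(s) = A x(s) + A₁ x(s - τ(s))`, where `τ` is a
sampling delay (so the initial datum is `x(0)`): Lyapunov stability and (global) attractivity.
All norms on `ℝⁿ` are equivalent, so the choice of the norm does not matter. -/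
def IsAsymptoticallyStable {n : ℕ} (A A₁ : Matrix (Fin n) (Fin n) ℝ) (τ : ℝ → ℝ) : Prop :=
  (∀ ε : ℝ, 0 < ε → ∃ δ : ℝ, 0 < δ ∧ ∀ x : ℝ → Fin n → ℝ, IsSolution A A₁ τ x →
      ‖x 0‖ < δ → ∀ s : ℝ, 0 ≤ s → ‖x s‖ < ε) ∧
    ∀ x : ℝ → Fin n → ℝ, IsSolution A A₁ τ x → Tendsto x atTop (𝓝 0)

/-- The uncertain sampled-data closed loop
`ẋ(s) = (A + H Δ E) x(s) + (B + H Δ F) K x(s - τ(s))` is robustly asymptotically stable for all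
samplings with maximal sampling interval `Ts`: it is asymptotically stable for every
`Δ = Diag(δ₁, …, δ_p)` with `|δᵢ| ≤ 1` and every admissible sampling. -/
def IsRobustlyAsymptoticallyStable {n m p : ℕ}
    (A : Matrix (Fin n) (Fin n) ℝ) (B : Matrix (Fin n) (Fin m) ℝ)
    (H : Matrix (Fin n) (Fin p) ℝ) (E : Matrix (Fin p) (Fin n) ℝ)
    (F : Matrix (Fin p) (Fin m) ℝ) (K : Matrix (Fin m) (Fin n) ℝ) (Ts : ℝ) : Prop :=
  ∀ δ : Fin p → ℝ, (∀ i, |δ i| ≤ 1) →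
    ∀ t : ℕ → ℝ, IsSampling Ts t → ∀ τ : ℝ → ℝ, IsSamplingDelay t τ →
      IsAsymptoticallyStable (A + H * diagonal δ * E) ((B + H * diagonal δ * F) * K) τ

/-- The symmetric `3 × 3` block matrix
`[S₁₁ S₁₂ S₁₃; * S₂₂ S₂₃; * * S₃₃]`. -/
def symBlock {n : ℕ} (S₁₁ S₁₂ S₁₃ S₂₂ S₂₃ S₃₃ : Matrix (Fin n) (Fin n) ℝ) :
    Matrix ((Fin n ⊕ Fin n) ⊕ Fin n) ((Fin n ⊕ Fin n) ⊕ Fin n) ℝ :=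
  fromBlocks (fromBlocks S₁₁ S₁₂ S₁₂ᵀ S₂₂) (fromRows S₁₃ S₂₃) (fromCols S₁₃ᵀ S₂₃ᵀ) S₃₃

/-- The matrix `W_{A,B}`. -/
def W {n m : ℕ} (Ts : ℝ) (A : Matrix (Fin n) (Fin n) ℝ) (B : Matrix (Fin n) (Fin m) ℝ)
    (Q₁ Q₂ Q₃ Z₁ Z₂ Z₃ R : Matrix (Fin n) (Fin n) ℝ) (Y : Matrix (Fin m) (Fin n) ℝ) :
    Matrix ((Fin n ⊕ Fin n) ⊕ Fin n) ((Fin n ⊕ Fin n) ⊕ Fin n) ℝ :=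
  symBlock
    (Q₂ + Q₂ᵀ + Ts • Z₁) (Q₃ - Q₂ᵀ + Q₁ * Aᵀ + Ts • Z₂ + Yᵀ * Bᵀ) (Ts • Q₂ᵀ)
                         (-Q₃ - Q₃ᵀ + Ts • Z₃)                    (Ts • Q₃ᵀ)
                                                                  (-(Ts • R))

/-- The `5 × 5` block matrix of the first matrix inequality. -/
def firstLMI {n m p : ℕ} (Ts : ℝ) (A : Matrix (Fin n) (Fin n) ℝ) (B : Matrix (Fin n) (Fin m) ℝ)
    (H : Matrix (Fin n) (Fin p) ℝ) (E : Matrix (Fin p) (Fin n) ℝ) (F : Matrix (Fin p) (Fin m) ℝ)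
    (Q₁ Q₂ Q₃ Z₁ Z₂ Z₃ R : Matrix (Fin n) (Fin n) ℝ) (Y : Matrix (Fin m) (Fin n) ℝ) (ε₁ : ℝ) :
    Matrix (((Fin n ⊕ Fin n) ⊕ Fin n) ⊕ (Fin p ⊕ Fin p))
      (((Fin n ⊕ Fin n) ⊕ Fin n) ⊕ (Fin p ⊕ Fin p)) ℝ :=
  let N : Matrix ((Fin n ⊕ Fin n) ⊕ Fin n) (Fin p ⊕ Fin p) ℝ :=
    fromRows (fromRows
      (fromCols 0 (ε₁ • (Q₁ * Eᵀ + Yᵀ * Fᵀ)))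
      (fromCols H 0))
      (fromCols 0 0)
  fromBlocks (W Ts A B Q₁ Q₂ Q₃ Z₁ Z₂ Z₃ R Y) N Nᵀ (fromBlocks (-(ε₁ • 1)) 0 0 (-(ε₁ • 1)))

/-- The `5 × 5` block matrix of the second matrix inequality. -/
def secondLMI {n m p : ℕ} (B : Matrix (Fin n) (Fin m) ℝ)
    (H : Matrix (Fin n) (Fin p) ℝ) (F : Matrix (Fin p) (Fin m) ℝ)
    (Q₁ Z₁ Z₂ Z₃ R : Matrix (Fin n) (Fin n) ℝ) (Y : Matrix (Fin m) (Fin n) ℝ) (ε₂ : ℝ) :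
    Matrix (((Fin n ⊕ Fin n) ⊕ Fin n) ⊕ (Fin p ⊕ Fin p))
      (((Fin n ⊕ Fin n) ⊕ Fin n) ⊕ (Fin p ⊕ Fin p)) ℝ :=
  let N : Matrix ((Fin n ⊕ Fin n) ⊕ Fin n) (Fin p ⊕ Fin p) ℝ :=
    fromRows (fromRows
      (fromCols 0 (ε₂ • (Yᵀ * Fᵀ)))
      (fromCols 0 0))
      (fromCols H 0)
  fromBlocks
    (symBlock ((2 : ℝ) • Q₁ - R) 0 (Yᵀ * Bᵀ)
                                 Z₁ Z₂
                                    Z₃)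
    N Nᵀ (fromBlocks (ε₂ • 1) 0 0 (ε₂ • 1))

end SampledData

/-!
Fix `Δ` and write `A`, `B` for the perturbed matrices `A + HΔE`, `B + HΔF`. Evaluating the two
matrix inequalities at vectors whose last two blocks are `Δz` and `±z`, where `z` is the input of
`Δ`, removes the uncertainty: since `|Δz| ≤ |z|`, the form of `W_{A,B}` is negative
(`W_form_neg`) and the upper left `3 × 3` part of the second inequality, with the perturbed `B`,
is nonnegative (`symBlock_form_nonneg`).

For fixed `Δ` the proof is a Lyapunov–Krasovskii argument on a single sampling interval
`[t_k, t_{k+1})`, where `ẋ = y = A x + B K x(t_k)`. Write `x = Q₁ a` and `y = Q₂ a + Q₃ b`, and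
let `V = xᵀ Q₁⁻¹ x`, so that `V̇ = 2 aᵀ y`. Adding `2 bᵀ (A x + B K x(t_k) - y) = 0` and bounding
the delayed part `2 bᵀ B K (x(t_k) - x)` by integrating the second inequality with
`u = Q₁⁻¹ y(σ)` (`increment_le`), the first inequality gives
`V̇ ≤ -e V - e r - Ts r + ∫ r`, where `r = yᵀ R⁻¹ y` and the integral runs over `[t_k, s]`
(`exists_dissipation`). The functional `V + (1 + η) ∫ (Ts - s + σ) r(σ) dσ`, whose integral term
vanishes at `t_k` and is nonnegative up to `t_{k+1}`, then decays exponentially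
(`exists_exp_decay`). As the integral term is dropped at each sampling instant, no history of the
solution is needed, and induction on `k` gives `V(x(s)) ≤ exp(-α s) V(x(0))` for all `s ≥ 0`
(`exists_exp_bound`), which contains both stability and attractivity.
-/

namespace SampledData

/-! ### Quadratic forms of the block matrices and elimination of the uncertainty -/

theorem dotProduct_transpose_mulVec {ι κ : Type*} [Fintype ι] [Fintype κ]
    (M : Matrix κ ι ℝ) (a : ι → ℝ) (b : κ → ℝ) : a ⬝ᵥ Mᵀ *ᵥ b = b ⬝ᵥ M *ᵥ a := by
  rw [mulVec_transpose, dotProduct_comm, dotProduct_mulVec]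

theorem symBlock_form {n : ℕ} (S₁₁ S₁₂ S₁₃ S₂₂ S₂₃ S₃₃ : Matrix (Fin n) (Fin n) ℝ)
    (a b c : Fin n → ℝ) :
    Sum.elim (Sum.elim a b) c ⬝ᵥ
        symBlock S₁₁ S₁₂ S₁₃ S₂₂ S₂₃ S₃₃ *ᵥ Sum.elim (Sum.elim a b) c =
      a ⬝ᵥ S₁₁ *ᵥ a + b ⬝ᵥ S₂₂ *ᵥ b + c ⬝ᵥ S₃₃ *ᵥ c +
        2 * (a ⬝ᵥ S₁₂ *ᵥ b + a ⬝ᵥ S₁₃ *ᵥ c + b ⬝ᵥ S₂₃ *ᵥ c) := by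
  simp only [symBlock, fromBlocks_mulVec, fromRows_mulVec, fromCols_mulVec, Sum.elim_comp_inl,
    Sum.elim_comp_inr, Sum.elim_add_add, sumElim_dotProduct_sumElim, dotProduct_add,
    dotProduct_transpose_mulVec]
  ring

/-- The form of `W_{A,B}`, grouped as in the derivative of the Lyapunov–Krasovskii functional:
`2 aᵀ y`, the term of the descriptor method with multiplier `b`, the `Z`-form, and a term
that for `c = R⁻¹ y` equals `Ts yᵀ R⁻¹ y`; here `y = Q₂ a + Q₃ b`. -/
theorem W_form {n m : ℕ} (Ts : ℝ) (A : Matrix (Fin n) (Fin n) ℝ) (B : Matrix (Fin n) (Fin m) ℝ)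
    (Q₁ Q₂ Q₃ Z₁ Z₂ Z₃ R : Matrix (Fin n) (Fin n) ℝ) (Y : Matrix (Fin m) (Fin n) ℝ)
    (hQ₁ : Q₁ᵀ = Q₁) (a b c : Fin n → ℝ) :
    Sum.elim (Sum.elim a b) c ⬝ᵥ
        W Ts A B Q₁ Q₂ Q₃ Z₁ Z₂ Z₃ R Y *ᵥ Sum.elim (Sum.elim a b) c =
      2 * (a ⬝ᵥ (Q₂ *ᵥ a + Q₃ *ᵥ b)) +
        2 * (b ⬝ᵥ (A *ᵥ Q₁ *ᵥ a + B *ᵥ Y *ᵥ a - (Q₂ *ᵥ a + Q₃ *ᵥ b))) +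
        Ts * (a ⬝ᵥ Z₁ *ᵥ a + 2 * (a ⬝ᵥ Z₂ *ᵥ b) + b ⬝ᵥ Z₃ *ᵥ b) +
        Ts * (2 * (c ⬝ᵥ (Q₂ *ᵥ a + Q₃ *ᵥ b)) - c ⬝ᵥ R *ᵥ c) := by
  have h1 : a ⬝ᵥ (Q₁ * Aᵀ) *ᵥ b = b ⬝ᵥ A *ᵥ Q₁ *ᵥ a := by
    rw [← dotProduct_transpose_mulVec, transpose_mul, transpose_transpose, hQ₁, mulVec_mulVec]
  have h2 : a ⬝ᵥ (Yᵀ * Bᵀ) *ᵥ b = b ⬝ᵥ B *ᵥ Y *ᵥ a := by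
    rw [← transpose_mul, dotProduct_transpose_mulVec, mulVec_mulVec]
  simp only [W, symBlock_form, add_mulVec, sub_mulVec, neg_mulVec, smul_mulVec, dotProduct_add,
    dotProduct_sub, dotProduct_neg, dotProduct_smul, smul_eq_mul, dotProduct_transpose_mulVec,
    h1, h2]
  ring

theorem bordered_form {ι κ : Type*} [Fintype ι] [Fintype κ] [DecidableEq κ]
    (S : Matrix ι ι ℝ) (N : Matrix ι (κ ⊕ κ) ℝ) (e : ℝ) (v : ι → ℝ) (w₁ w₂ : κ → ℝ) :
    Sum.elim v (Sum.elim w₁ w₂) ⬝ᵥ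
        fromBlocks S N Nᵀ (fromBlocks (e • 1) 0 0 (e • 1)) *ᵥ Sum.elim v (Sum.elim w₁ w₂) =
      v ⬝ᵥ S *ᵥ v + 2 * (v ⬝ᵥ N *ᵥ Sum.elim w₁ w₂) + e * (w₁ ⬝ᵥ w₁ + w₂ ⬝ᵥ w₂) := by
  simp only [fromBlocks_mulVec, Sum.elim_comp_inl, Sum.elim_comp_inr,
    sumElim_dotProduct_sumElim, dotProduct_add, dotProduct_transpose_mulVec, smul_mulVec,
    one_mulVec, zero_mulVec, add_zero, zero_add, dotProduct_smul, smul_eq_mul]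
  ring

theorem diagonal_mulVec_dotProduct_self_le {κ : Type*} [Fintype κ] [DecidableEq κ] {δ : κ → ℝ}
    (hδ : ∀ i, |δ i| ≤ 1) (z : κ → ℝ) :
    (diagonal δ *ᵥ z) ⬝ᵥ (diagonal δ *ᵥ z) ≤ z ⬝ᵥ z := by
  refine Finset.sum_le_sum fun i _ => ?_
  rw [mulVec_diagonal]
  have h1 : δ i ^ 2 ≤ 1 := (sq_le_one_iff_abs_le_one _).2 (hδ i)
  nlinarith [mul_le_mul_of_nonneg_right h1 (sq_nonneg (z i))]

/-- The first matrix inequality makes the form of `W` negative for every admissible `Δ`: evaluate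
it at `(v, Δz, z)` with `z = (E Q₁ + F Y) a`. -/
theorem W_form_neg {n m p : ℕ} {Ts : ℝ} {A : Matrix (Fin n) (Fin n) ℝ}
    {B : Matrix (Fin n) (Fin m) ℝ} {H : Matrix (Fin n) (Fin p) ℝ} {E : Matrix (Fin p) (Fin n) ℝ}
    {F : Matrix (Fin p) (Fin m) ℝ} {Q₁ Q₂ Q₃ Z₁ Z₂ Z₃ R : Matrix (Fin n) (Fin n) ℝ}
    {Y : Matrix (Fin m) (Fin n) ℝ} {ε₁ : ℝ} (hQ₁ : Q₁ᵀ = Q₁) (hε₁ : 0 < ε₁)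
    (h₁ : (-firstLMI Ts A B H E F Q₁ Q₂ Q₃ Z₁ Z₂ Z₃ R Y ε₁).PosDef)
    {δ : Fin p → ℝ} (hδ : ∀ i, |δ i| ≤ 1) {v : (Fin n ⊕ Fin n) ⊕ Fin n → ℝ} (hv : v ≠ 0) :
    v ⬝ᵥ W Ts (A + H * diagonal δ * E) (B + H * diagonal δ * F) Q₁ Q₂ Q₃ Z₁ Z₂ Z₃ R Y *ᵥ v
      < 0 := by
  obtain ⟨a, b, c, rfl⟩ : ∃ a b c, v = Sum.elim (Sum.elim a b) c :=
    ⟨_, _, _, by rw [Sum.elim_comp_inl_inr, Sum.elim_comp_inl_inr]⟩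
  set z : Fin p → ℝ := E *ᵥ Q₁ *ᵥ a + F *ᵥ Y *ᵥ a with hz
  have hne : Sum.elim (Sum.elim (Sum.elim a b) c) (Sum.elim (diagonal δ *ᵥ z) z) ≠ 0 := by
    intro h
    exact hv (by simpa using congrArg (fun f => f ∘ Sum.inl) h)
  have key := h₁.dotProduct_mulVec_pos hne
  have hN : a ⬝ᵥ (Q₁ * Eᵀ + Yᵀ * Fᵀ) *ᵥ z = z ⬝ᵥ z := by
    have : Q₁ * Eᵀ + Yᵀ * Fᵀ = (E * Q₁ + F * Y)ᵀ := by
      rw [transpose_add, transpose_mul, transpose_mul, hQ₁]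
    rw [this, dotProduct_transpose_mulVec, add_mulVec, ← mulVec_mulVec, ← mulVec_mulVec]
  have hneg : -(ε₁ • (1 : Matrix (Fin p) (Fin p) ℝ)) = (-ε₁) • 1 := (neg_smul _ _).symm
  rw [star_trivial, neg_mulVec, dotProduct_neg, firstLMI, hneg, bordered_form,
    W_form (hQ₁ := hQ₁)] at key
  simp only [fromRows_mulVec, fromCols_mulVec, Sum.elim_comp_inl, Sum.elim_comp_inr,
    sumElim_dotProduct_sumElim, zero_mulVec, zero_add, add_zero, smul_mulVec,
    dotProduct_smul, hN, dotProduct_zero, smul_eq_mul] at key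
  rw [W_form (hQ₁ := hQ₁)]
  have hΔ : (A + H * diagonal δ * E) *ᵥ Q₁ *ᵥ a + (B + H * diagonal δ * F) *ᵥ Y *ᵥ a =
      A *ᵥ Q₁ *ᵥ a + B *ᵥ Y *ᵥ a + H *ᵥ diagonal δ *ᵥ z := by
    simp only [hz, add_mulVec, ← mulVec_mulVec, mulVec_add]
    abel
  rw [hΔ]
  have hsq := mul_le_mul_of_nonneg_left (diagonal_mulVec_dotProduct_self_le hδ z) hε₁.le
  simp only [dotProduct_add, dotProduct_sub] at key ⊢
  linarith

/-- The second matrix inequality for every admissible `Δ`: evaluate it at `(u, a, b, Δz, -z)` with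
`z = F Y u`. -/
theorem symBlock_form_nonneg {n m p : ℕ} {B : Matrix (Fin n) (Fin m) ℝ}
    {H : Matrix (Fin n) (Fin p) ℝ} {F : Matrix (Fin p) (Fin m) ℝ}
    {Q₁ Z₁ Z₂ Z₃ R : Matrix (Fin n) (Fin n) ℝ} {Y : Matrix (Fin m) (Fin n) ℝ} {ε₂ : ℝ}
    (hε₂ : 0 < ε₂) (h₂ : (secondLMI B H F Q₁ Z₁ Z₂ Z₃ R Y ε₂).PosSemidef)
    {δ : Fin p → ℝ} (hδ : ∀ i, |δ i| ≤ 1) (u a b : Fin n → ℝ) :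
    0 ≤ 2 * (u ⬝ᵥ Q₁ *ᵥ u) - u ⬝ᵥ R *ᵥ u +
      2 * (b ⬝ᵥ (B + H * diagonal δ * F) *ᵥ Y *ᵥ u) +
      (a ⬝ᵥ Z₁ *ᵥ a + 2 * (a ⬝ᵥ Z₂ *ᵥ b) + b ⬝ᵥ Z₃ *ᵥ b) := by
  set z : Fin p → ℝ := F *ᵥ Y *ᵥ u with hz
  have key := h₂.dotProduct_mulVec_nonneg
    (Sum.elim (Sum.elim (Sum.elim u a) b) (Sum.elim (diagonal δ *ᵥ z) (-z)))
  have hN : u ⬝ᵥ (Yᵀ * Fᵀ) *ᵥ z = z ⬝ᵥ z := by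
    rw [← transpose_mul, dotProduct_transpose_mulVec, ← mulVec_mulVec]
  have hB : u ⬝ᵥ (Yᵀ * Bᵀ) *ᵥ b = b ⬝ᵥ B *ᵥ Y *ᵥ u := by
    rw [← transpose_mul, dotProduct_transpose_mulVec, mulVec_mulVec]
  rw [star_trivial, secondLMI, bordered_form, symBlock_form] at key
  simp only [fromRows_mulVec, fromCols_mulVec, Sum.elim_comp_inl, Sum.elim_comp_inr,
    sumElim_dotProduct_sumElim, zero_mulVec, zero_add, neg_zero, add_zero, smul_mulVec, mulVec_neg,
    dotProduct_smul, dotProduct_neg, neg_dotProduct, hN, hB, dotProduct_zero, smul_eq_mul,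
    sub_mulVec, dotProduct_sub] at key
  have hΔ : (B + H * diagonal δ * F) *ᵥ Y *ᵥ u = B *ᵥ Y *ᵥ u + H *ᵥ diagonal δ *ᵥ z := by
    simp only [hz, add_mulVec, ← mulVec_mulVec]
  rw [hΔ]
  have hsq := mul_le_mul_of_nonneg_left (diagonal_mulVec_dotProduct_self_le hδ z) hε₂.le
  simp only [dotProduct_add] at key ⊢
  linarith

/-- A positive form dominates a positive multiple of any other form, by compactness of the unit
sphere. -/
theorem exists_pos_mul_form_le {ι : Type*} [Fintype ι] {M : Matrix ι ι ℝ}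
    (hM : ∀ v, v ≠ 0 → 0 < v ⬝ᵥ M *ᵥ v) (N : Matrix ι ι ℝ) :
    ∃ e : ℝ, 0 < e ∧ ∀ v : ι → ℝ, e * (v ⬝ᵥ N *ᵥ v) ≤ v ⬝ᵥ M *ᵥ v := by
  have hcont : ∀ L : Matrix ι ι ℝ, Continuous fun v : ι → ℝ => v ⬝ᵥ L *ᵥ v := fun L => by
    fun_prop
  have hne : ∀ v ∈ Metric.sphere (0 : ι → ℝ) 1, v ≠ 0 := fun v hv h => by
    simp [h] at hv
  obtain ⟨C, hC⟩ := ((isCompact_sphere (0 : ι → ℝ) 1).image_of_continuousOn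
    (f := fun v => (v ⬝ᵥ N *ᵥ v) / (v ⬝ᵥ M *ᵥ v))
    ((hcont N).continuousOn.div (hcont M).continuousOn
      fun v hv => (hM v (hne v hv)).ne')).bddAbove
  refine ⟨(|C| + 1)⁻¹, by positivity, fun v => ?_⟩
  rcases eq_or_ne v 0 with rfl | hv
  · simp
  have hv' : ‖v‖⁻¹ • v ∈ Metric.sphere (0 : ι → ℝ) 1 := by
    simp [norm_smul, norm_ne_zero_iff.2 hv]
  have h := hC (mem_image_of_mem _ hv')
  have hpos : ‖v‖ ≠ 0 := norm_ne_zero_iff.2 hv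
  simp only [mulVec_smul, dotProduct_smul, smul_dotProduct, smul_eq_mul] at h
  rw [mul_div_mul_left _ _ (inv_ne_zero hpos), mul_div_mul_left _ _ (inv_ne_zero hpos),
    div_le_iff₀ (hM v hv)] at h
  rw [inv_mul_le_iff₀ (by positivity)]
  exact h.trans (mul_le_mul_of_nonneg_right (by linarith [le_abs_self C]) (hM v hv).le)

/-! ### Differential inequalities on one sampling interval -/

/-- The scalar core of the Lyapunov–Krasovskii argument. The decay rate depends only on `e` and
`Ts`, hence is the same for all sampling intervals. -/
theorem exists_exp_decay {e Ts : ℝ} (he : 0 < e) (hTs : 0 < Ts) :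
    ∃ α : ℝ, 0 < α ∧ ∀ (V V' r : ℝ → ℝ) (t₀ t₁ : ℝ), t₁ - t₀ ≤ Ts → Continuous r →
      (∀ s, 0 ≤ r s) → ContinuousOn V (Icc t₀ t₁) → (∀ s, 0 ≤ V s) →
      (∀ s ∈ Ico t₀ t₁, HasDerivWithinAt V (V' s) (Ici s) s) →
      (∀ s ∈ Ico t₀ t₁, V' s ≤ -e * V s - e * r s - Ts * r s + ∫ σ in t₀..s, r σ) →
      ∀ s ∈ Icc t₀ t₁, V s ≤ Real.exp (-α * (s - t₀)) * V t₀ := by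
  -- `η` is the strict excess in the weight `1 + η` of the integral term: it leaves `-η ∫ r` in
  -- the derivative, at the price of `η Ts r = e r`.
  set η := e / Ts with hη
  have hη0 : 0 < η := by positivity
  have hηTs : η * Ts = e := by rw [hη]; field_simp
  set α := min e (η / ((1 + η) * Ts)) with hα
  have hα0 : 0 < α := by positivity
  have hα1 : α ≤ e := min_le_left _ _
  have hα2 : α * ((1 + η) * Ts) ≤ η := by
    rw [← le_div_iff₀ (by positivity)]
    exact min_le_right _ _
  refine ⟨α, hα0, fun V V' r t₀ t₁ hlen hr hr0 hV hV0 hVd hle => ?_⟩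
  set I : ℝ → ℝ := fun s => ∫ σ in t₀..s, r σ with hI
  -- With `I = ∫ r` and `J = ∫ I`, the integral `∫ (Ts - s + σ) r(σ) dσ` equals `Ts * I - J`.
  set J : ℝ → ℝ := fun s => ∫ σ in t₀..s, I σ with hJ
  have hId : ∀ s, HasDerivAt I (r s) s := fun s => (hr.integral_hasStrictDerivAt t₀ s).hasDerivAt
  have hIc : Continuous I := continuous_iff_continuousAt.2 fun s => (hId s).continuousAt
  have hJd : ∀ s, HasDerivAt J (I s) s := fun s => (hIc.integral_hasStrictDerivAt t₀ s).hasDerivAt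
  have hJc : Continuous J := continuous_iff_continuousAt.2 fun s => (hJd s).continuousAt
  have hImono : Monotone I := monotone_of_hasDerivAt_nonneg hId hr0
  have hI₀ : I t₀ = 0 := intervalIntegral.integral_same
  have hJ₀ : J t₀ = 0 := intervalIntegral.integral_same
  have hI0 : ∀ s, t₀ ≤ s → 0 ≤ I s := fun s hs => hI₀ ▸ hImono hs
  have hJ0 : ∀ s, t₀ ≤ s → 0 ≤ J s := fun s hs =>
    intervalIntegral.integral_nonneg hs fun σ hσ => hI0 σ hσ.1
  have hJI : ∀ s ∈ Icc t₀ t₁, J s ≤ Ts * I s := fun s hs => by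
    have h := intervalIntegral.integral_mono_on (μ := MeasureTheory.volume) hs.1
      (hIc.intervalIntegrable _ _) (intervalIntegrable_const (c := I s))
      fun σ hσ => hImono hσ.2
    rw [intervalIntegral.integral_const, smul_eq_mul] at h
    exact h.trans (mul_le_mul_of_nonneg_right (by linarith [hs.2]) (hI0 s hs.1))
  have hexp : ∀ s, HasDerivAt (fun s => Real.exp (α * (s - t₀)))
      (Real.exp (α * (s - t₀)) * α) s := fun s => by
    simpa using (((hasDerivAt_id s).sub_const t₀).const_mul α).exp
  have hmain : ∀ s ∈ Icc t₀ t₁,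
      Real.exp (α * (s - t₀)) * (V s + (1 + η) * (Ts * I s - J s)) ≤ V t₀ := by
    refine image_le_of_deriv_right_le_deriv_boundary (B := fun _ => V t₀) (B' := fun _ => 0)
      (f' := fun s => Real.exp (α * (s - t₀)) * α * (V s + (1 + η) * (Ts * I s - J s)) +
        Real.exp (α * (s - t₀)) * (V' s + (1 + η) * (Ts * r s - I s))) ?_ ?_ ?_
      continuousOn_const (fun s _ => hasDerivWithinAt_const _ _ _) ?_
    · have : Continuous fun s => Real.exp (α * (s - t₀)) := by fun_prop
      exact this.continuousOn.mul (hV.add (by fun_prop : Continuous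
        fun s => (1 + η) * (Ts * I s - J s)).continuousOn)
    · intro s hs
      exact (hexp s).hasDerivWithinAt.mul ((hVd s hs).add
        ((((hId s).const_mul Ts).sub (hJd s)).const_mul (1 + η)).hasDerivWithinAt)
    · simp [hI₀, hJ₀]
    · intro s hs
      have h1 := hle s hs
      have h2 := hJ0 s hs.1
      have h3 := hI0 s hs.1
      have h4 : α * V s ≤ e * V s := mul_le_mul_of_nonneg_right hα1 (hV0 s)
      have h5 := mul_le_mul_of_nonneg_right hα2 h3
      have h6 : 0 ≤ α * (1 + η) * J s := by positivity
      have h7 : η * Ts * r s = e * r s := by rw [hηTs]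
      have h8 : α * (V s + (1 + η) * (Ts * I s - J s)) +
          (V' s + (1 + η) * (Ts * r s - I s)) ≤ 0 := by
        change V' s ≤ -e * V s - e * r s - Ts * r s + I s at h1
        linarith
      have h9 := mul_nonpos_of_nonneg_of_nonpos (Real.exp_pos (α * (s - t₀))).le h8
      linarith
  intro s hs
  have h1 := hmain s hs
  have h2 : 0 ≤ (1 + η) * (Ts * I s - J s) :=
    mul_nonneg (by positivity) (sub_nonneg.2 (hJI s hs))
  rw [neg_mul, Real.exp_neg, le_inv_mul_iff₀ (Real.exp_pos _)]
  refine le_trans (mul_le_mul_of_nonneg_left ?_ (Real.exp_pos _).le) h1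
  linarith

theorem hasDerivWithinAt_dotProduct {ι : Type*} [Fintype ι] {f g : ℝ → ι → ℝ} {f' g' : ι → ℝ}
    {s : Set ℝ} {t : ℝ} (hf : HasDerivWithinAt f f' s t) (hg : HasDerivWithinAt g g' s t) :
    HasDerivWithinAt (fun u => f u ⬝ᵥ g u) (f' ⬝ᵥ g t + f t ⬝ᵥ g') s t := by
  rw [dotProduct, dotProduct, ← Finset.sum_add_distrib]
  exact HasDerivWithinAt.fun_sum fun i _ =>
    (hasDerivWithinAt_pi.1 hf i).mul (hasDerivWithinAt_pi.1 hg i)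

theorem hasDerivWithinAt_mulVec {ι κ : Type*} [Fintype ι] [Fintype κ] (M : Matrix κ ι ℝ)
    {f : ℝ → ι → ℝ} {f' : ι → ℝ} {s : Set ℝ} {t : ℝ} (hf : HasDerivWithinAt f f' s t) :
    HasDerivWithinAt (fun u => M *ᵥ f u) (M *ᵥ f') s t :=
  hasDerivWithinAt_pi.2 fun _ => HasDerivWithinAt.fun_sum fun j _ =>
    (hasDerivWithinAt_pi.1 hf j).const_mul _

/-- Integrated form of the pointwise bound on the delayed term; `y` is the right derivative of `x`,
so no integral of the vector-valued `y` is needed. -/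
theorem increment_le {n : ℕ} {x y : ℝ → Fin n → ℝ} {r : ℝ → ℝ} {t₀ t₁ c : ℝ} (w : Fin n → ℝ)
    (hx : ContinuousOn x (Icc t₀ t₁))
    (hxd : ∀ s ∈ Ico t₀ t₁, HasDerivWithinAt x (y s) (Ici s) s) (hr : Continuous r)
    (hle : ∀ s ∈ Ico t₀ t₁, -(w ⬝ᵥ y s) ≤ r s + c) :
    ∀ s ∈ Icc t₀ t₁, w ⬝ᵥ (x t₀ - x s) ≤ (∫ σ in t₀..s, r σ) + (s - t₀) * c := by
  have hI : ∀ s, HasDerivAt (fun s => (∫ σ in t₀..s, r σ) + (s - t₀) * c) (r s + c) s :=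
    fun s => by
    simpa using (hr.integral_hasStrictDerivAt t₀ s).hasDerivAt.fun_add
      (((hasDerivAt_id s).sub_const t₀).mul_const c)
  refine image_le_of_deriv_right_le_deriv_boundary (f' := fun s => -(w ⬝ᵥ y s)) ?_ ?_ ?_
    (fun s _ => (hI s).continuousAt.continuousWithinAt)
    (fun s _ => (hI s).hasDerivWithinAt) hle
  · exact (by fun_prop : Continuous fun z : Fin n → ℝ => w ⬝ᵥ (x t₀ - z)).comp_continuousOn hx
  · intro s hs
    simpa using hasDerivWithinAt_dotProduct (hasDerivWithinAt_const s (Ici s) w)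
      ((hxd s hs).const_sub (x t₀))
  · simp

/-! ### Stability for fixed system matrices -/

theorem posDef_form_pos {ι : Type*} [Fintype ι] {M : Matrix ι ι ℝ} (hM : M.PosDef) {v : ι → ℝ}
    (hv : v ≠ 0) : 0 < v ⬝ᵥ M *ᵥ v := by
  simpa using hM.dotProduct_mulVec_pos hv

/-- `2 Q⁻¹ - Q⁻¹ R Q⁻¹ ≤ R⁻¹`, which is the expansion of `(R⁻¹ - Q⁻¹) R (R⁻¹ - Q⁻¹) ≥ 0`. -/
theorem two_mul_form_sub_form_le_inv_form {n : ℕ} {Q R : Matrix (Fin n) (Fin n) ℝ} (hQ : Q.PosDef)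
    (hR : R.PosDef) (y : Fin n → ℝ) :
    2 * ((Q⁻¹ *ᵥ y) ⬝ᵥ Q *ᵥ Q⁻¹ *ᵥ y) - (Q⁻¹ *ᵥ y) ⬝ᵥ R *ᵥ Q⁻¹ *ᵥ y ≤ y ⬝ᵥ R⁻¹ *ᵥ y := by
  have hRt : Rᵀ = R := by simpa [IsHermitian] using hR.isHermitian
  have hQu : Q *ᵥ Q⁻¹ *ᵥ y = y := by
    rw [mulVec_mulVec, mul_nonsing_inv _ ((isUnit_iff_isUnit_det _).1 hQ.isUnit), one_mulVec]
  set c := R⁻¹ *ᵥ y with hc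
  have hRc : R *ᵥ c = y := by
    rw [hc, mulVec_mulVec, mul_nonsing_inv _ ((isUnit_iff_isUnit_det _).1 hR.isUnit), one_mulVec]
  set u := Q⁻¹ *ᵥ y
  have h := hR.posSemidef.dotProduct_mulVec_nonneg (c - u)
  have h2 : c ⬝ᵥ R *ᵥ u = u ⬝ᵥ y := by
    rw [← hRc, ← dotProduct_transpose_mulVec, hRt]
  rw [star_trivial, mulVec_sub, dotProduct_sub, sub_dotProduct, sub_dotProduct, hRc, h2] at h
  rw [hQu, dotProduct_comm y c]
  linarith

section Nominal

variable {n m : ℕ} {Ts : ℝ} {A : Matrix (Fin n) (Fin n) ℝ} {B : Matrix (Fin n) (Fin m) ℝ}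
  {Q₁ Q₂ Q₃ Z₁ Z₂ Z₃ R : Matrix (Fin n) (Fin n) ℝ} {Y : Matrix (Fin m) (Fin n) ℝ}

/-- The middle block of `W` forces `Q₃ + Q₃ᵀ` to be positive definite, so that the derivative
`y = Q₂ a + Q₃ b` determines a multiplier `b`. -/
theorem isUnit_of_W_form_neg (hTs : 0 < Ts) (hQ₁ : Q₁ᵀ = Q₁)
    (hW : ∀ v : (Fin n ⊕ Fin n) ⊕ Fin n → ℝ, v ≠ 0 →
      v ⬝ᵥ W Ts A B Q₁ Q₂ Q₃ Z₁ Z₂ Z₃ R Y *ᵥ v < 0)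
    (hZ₃ : ∀ b : Fin n → ℝ, 0 ≤ b ⬝ᵥ Z₃ *ᵥ b) : IsUnit Q₃ := by
  rw [← mulVec_injective_iff_isUnit]
  refine (injective_iff_map_eq_zero Q₃.mulVecLin).2 fun b hb => ?_
  rw [mulVecLin_apply] at hb
  by_contra hb0
  have h := hW (Sum.elim (Sum.elim 0 b) 0) fun h0 => hb0 <| funext fun i => by
    simpa using congrFun h0 (Sum.inl (Sum.inr i))
  rw [W_form (hQ₁ := hQ₁)] at h
  simp only [hb, mulVec_zero, zero_dotProduct, dotProduct_zero, add_zero, mul_zero, sub_zero,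
    zero_add] at h
  exact h.not_ge (mul_nonneg hTs.le (hZ₃ b))

/-- Bound on the derivative `2 (Q₁⁻¹ x)ᵀ y` of `xᵀ Q₁⁻¹ x`. Here `x₀` is the state at the last
sampling instant and `J` stands for the integral of `yᵀ R⁻¹ y` since then. -/
theorem exists_dissipation (hTs : 0 < Ts) (hQ₁ : Q₁.PosDef) (hR : R.PosDef)
    (hW : ∀ v : (Fin n ⊕ Fin n) ⊕ Fin n → ℝ, v ≠ 0 →
      v ⬝ᵥ W Ts A B Q₁ Q₂ Q₃ Z₁ Z₂ Z₃ R Y *ᵥ v < 0)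
    (hZ₃ : ∀ b : Fin n → ℝ, 0 ≤ b ⬝ᵥ Z₃ *ᵥ b) :
    ∃ e : ℝ, 0 < e ∧ ∀ (x x₀ y : Fin n → ℝ) (J : ℝ), y = A *ᵥ x + (B * (Y * Q₁⁻¹)) *ᵥ x₀ →
      (∀ a b : Fin n → ℝ, 2 * (b ⬝ᵥ (B * (Y * Q₁⁻¹)) *ᵥ (x₀ - x)) ≤
        J + Ts * (a ⬝ᵥ Z₁ *ᵥ a + 2 * (a ⬝ᵥ Z₂ *ᵥ b) + b ⬝ᵥ Z₃ *ᵥ b)) →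
      2 * ((Q₁⁻¹ *ᵥ x) ⬝ᵥ y) ≤ -e * (x ⬝ᵥ Q₁⁻¹ *ᵥ x) - e * (y ⬝ᵥ R⁻¹ *ᵥ y) -
        Ts * (y ⬝ᵥ R⁻¹ *ᵥ y) + J := by
  have hQt : Q₁ᵀ = Q₁ := by simpa [IsHermitian] using hQ₁.isHermitian
  obtain ⟨e, he, hle⟩ := exists_pos_mul_form_le
    (M := -W Ts A B Q₁ Q₂ Q₃ Z₁ Z₂ Z₃ R Y)
    (fun v hv => by rw [neg_mulVec, dotProduct_neg]; exact neg_pos.2 (hW v hv))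
    (symBlock Q₁ 0 0 0 0 R)
  refine ⟨e, he, fun x x₀ y J hy hJ => ?_⟩
  obtain ⟨a, ha, hax⟩ : ∃ a, Q₁⁻¹ *ᵥ x = a ∧ Q₁ *ᵥ a = x := ⟨_, rfl, by
    rw [mulVec_mulVec, mul_nonsing_inv _ ((isUnit_iff_isUnit_det _).1 hQ₁.isUnit), one_mulVec]⟩
  obtain ⟨b, hb⟩ := mulVec_surjective_iff_isUnit.2 (isUnit_of_W_form_neg hTs hQt hW hZ₃)
    (y - Q₂ *ᵥ a)
  have hyab : Q₂ *ᵥ a + Q₃ *ᵥ b = y := by simp [hb]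
  obtain ⟨c, hc, hcy⟩ : ∃ c, R⁻¹ *ᵥ y = c ∧ R *ᵥ c = y := ⟨_, rfl, by
    rw [mulVec_mulVec, mul_nonsing_inv _ ((isUnit_iff_isUnit_det _).1 hR.isUnit), one_mulVec]⟩
  have h := hle (Sum.elim (Sum.elim a b) c)
  rw [neg_mulVec, dotProduct_neg, W_form (hQ₁ := hQt), symBlock_form, hyab, hcy, hax] at h
  have hBY : (B * (Y * Q₁⁻¹)) *ᵥ x = B *ᵥ Y *ᵥ a := by
    rw [← mulVec_mulVec, ← mulVec_mulVec, ha]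
  have h2 := hJ a b
  have h3 : b ⬝ᵥ (A *ᵥ x + B *ᵥ Y *ᵥ a - y) = -(b ⬝ᵥ (B * (Y * Q₁⁻¹)) *ᵥ (x₀ - x)) := by
    rw [hy, ← hBY, mulVec_sub, ← dotProduct_neg]
    congr 1
    abel
  simp only [zero_mulVec, dotProduct_zero, add_zero, mul_zero] at h
  rw [h3, dotProduct_comm c y, dotProduct_comm a x] at h
  rw [ha, hc]
  linarith

/-- Exponential decay of `xᵀ Q₁⁻¹ x` along all solutions, with a rate that depends only on the
data of the inequalities. -/
theorem exists_exp_bound (hQ₁ : Q₁.PosDef) (hR : R.PosDef)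
    (hW : ∀ v : (Fin n ⊕ Fin n) ⊕ Fin n → ℝ, v ≠ 0 →
      v ⬝ᵥ W Ts A B Q₁ Q₂ Q₃ Z₁ Z₂ Z₃ R Y *ᵥ v < 0)
    (hS : ∀ u a b : Fin n → ℝ, 0 ≤ 2 * (u ⬝ᵥ Q₁ *ᵥ u) - u ⬝ᵥ R *ᵥ u +
      2 * (b ⬝ᵥ B *ᵥ Y *ᵥ u) + (a ⬝ᵥ Z₁ *ᵥ a + 2 * (a ⬝ᵥ Z₂ *ᵥ b) + b ⬝ᵥ Z₃ *ᵥ b))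
    {t : ℕ → ℝ} (ht : IsSampling Ts t) {τ : ℝ → ℝ} (hτ : IsSamplingDelay t τ) :
    ∃ α : ℝ, 0 < α ∧ ∀ x, IsSolution A (B * (Y * Q₁⁻¹)) τ x → ∀ s, 0 ≤ s →
      x s ⬝ᵥ Q₁⁻¹ *ᵥ x s ≤ Real.exp (-α * s) * (x 0 ⬝ᵥ Q₁⁻¹ *ᵥ x 0) := by
  have hTs : 0 < Ts := by
    have := ht.interval_le 0
    have := ht.strictMono (Nat.lt_add_one 0)
    linarith
  have hPt : (Q₁⁻¹)ᵀ = Q₁⁻¹ := by simpa [IsHermitian] using hQ₁.inv.isHermitian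
  have hZ : ∀ a b : Fin n → ℝ, 0 ≤ a ⬝ᵥ Z₁ *ᵥ a + 2 * (a ⬝ᵥ Z₂ *ᵥ b) + b ⬝ᵥ Z₃ *ᵥ b :=
    fun a b => by simpa using hS 0 a b
  have hdelay : ∀ y a b : Fin n → ℝ, -(2 * (b ⬝ᵥ (B * (Y * Q₁⁻¹)) *ᵥ y)) ≤
      y ⬝ᵥ R⁻¹ *ᵥ y + (a ⬝ᵥ Z₁ *ᵥ a + 2 * (a ⬝ᵥ Z₂ *ᵥ b) + b ⬝ᵥ Z₃ *ᵥ b) := fun y a b => by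
    have h1 := hS (Q₁⁻¹ *ᵥ y) a b
    have h2 := two_mul_form_sub_form_le_inv_form hQ₁ hR y
    rw [← mulVec_mulVec, ← mulVec_mulVec]
    linarith
  obtain ⟨e, he, hdiss⟩ := exists_dissipation hTs hQ₁ hR hW fun b => by simpa using hZ 0 b
  obtain ⟨α, hα, hdecay⟩ := exists_exp_decay he hTs
  refine ⟨α, hα, fun x hx => ?_⟩
  set P := Q₁⁻¹
  -- A solution is only continuous on `[0, ∞)`; freezing it at `x 0` on the negative axis makes the
  -- integrand `r` below continuous on all of `ℝ`.
  have hxc : Continuous fun s => x (max s 0) :=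
    hx.1.comp_continuous (by fun_prop) fun s => mem_Ici.2 (le_max_right _ _)
  have htn : ∀ k, 0 ≤ t k := fun k => ht.zero ▸ ht.strictMono.monotone (Nat.zero_le k)
  have hstep : ∀ k, ∀ s ∈ Icc (t k) (t (k + 1)),
      x s ⬝ᵥ P *ᵥ x s ≤ Real.exp (-α * (s - t k)) * (x (t k) ⬝ᵥ P *ᵥ x (t k)) := by
    intro k
    set y : ℝ → Fin n → ℝ := fun s => A *ᵥ x (max s 0) + (B * (Y * P)) *ᵥ x (t k) with hy
    have hyc : Continuous y := (continuous_const.matrix_mulVec hxc).add continuous_const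
    have hxI : ContinuousOn x (Icc (t k) (t (k + 1))) :=
      hx.1.mono fun s hs => (htn k).trans hs.1
    have hymax : ∀ s, t k ≤ s → y s = A *ᵥ x s + (B * (Y * P)) *ᵥ x (t k) := fun s hs => by
      rw [hy]
      simp only [max_eq_left ((htn k).trans hs)]
    have hxd : ∀ s ∈ Ico (t k) (t (k + 1)), HasDerivWithinAt x (y s) (Ici s) s := by
      intro s hs
      have h := hx.2 s ((htn k).trans hs.1)
      rwa [hτ k s hs, sub_sub_cancel, ← hymax s hs.1] at h
    set r : ℝ → ℝ := fun s => y s ⬝ᵥ R⁻¹ *ᵥ y s with hr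
    have hrc : Continuous r := by fun_prop
    have hr0 : ∀ s, 0 ≤ r s := fun s => by
      simpa using hR.inv.posSemidef.dotProduct_mulVec_nonneg (y s)
    refine hdecay (fun s => x s ⬝ᵥ P *ᵥ x s) (fun s => 2 * ((P *ᵥ x s) ⬝ᵥ y s)) r _ _
      (ht.interval_le k) hrc hr0 ?_ ?_ ?_ ?_
    · exact (by fun_prop : Continuous fun z : Fin n → ℝ => z ⬝ᵥ P *ᵥ z).comp_continuousOn hxI
    · exact fun s => by simpa using hQ₁.inv.posSemidef.dotProduct_mulVec_nonneg (x s)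
    · intro s hs
      refine (hasDerivWithinAt_dotProduct (hxd s hs)
        (hasDerivWithinAt_mulVec P (hxd s hs))).congr_deriv ?_
      have hsymm := dotProduct_transpose_mulVec P (x s) (y s)
      rw [hPt] at hsymm
      rw [hsymm, dotProduct_comm (P *ᵥ x s) (y s), two_mul]
    · intro s hs
      refine hdiss (x s) (x (t k)) (y s) _ (hymax s hs.1) fun a b => ?_
      have hinc := increment_le ((2 : ℝ) • b ᵥ* (B * (Y * P))) hxI hxd hrc
        (c := a ⬝ᵥ Z₁ *ᵥ a + 2 * (a ⬝ᵥ Z₂ *ᵥ b) + b ⬝ᵥ Z₃ *ᵥ b) (fun σ _ => by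
          rw [smul_dotProduct, ← dotProduct_mulVec, smul_eq_mul]
          exact hdelay (y σ) a b) s ⟨hs.1, hs.2.le⟩
      rw [smul_dotProduct, ← dotProduct_mulVec, smul_eq_mul] at hinc
      refine hinc.trans (add_le_add le_rfl (mul_le_mul_of_nonneg_right ?_ (hZ a b)))
      linarith [ht.interval_le k, hs.2]
  have hnode : ∀ k, x (t k) ⬝ᵥ P *ᵥ x (t k) ≤
      Real.exp (-α * t k) * (x 0 ⬝ᵥ P *ᵥ x 0) := by
    intro k
    induction k with
    | zero => simp [ht.zero]
    | succ k ih =>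
      have h := hstep k _ (right_mem_Icc.2 (ht.strictMono (Nat.lt_succ_self k)).le)
      refine h.trans ((mul_le_mul_of_nonneg_left ih (Real.exp_pos _).le).trans_eq ?_)
      rw [← mul_assoc, ← Real.exp_add]
      ring_nf
  intro s hs
  obtain ⟨k, hk⟩ : ∃ k, s ∈ Ico (t k) (t (k + 1)) := by
    have hex : ∃ j, s < t j := ((ht.tendsto.eventually_gt_atTop s).exists)
    classical
    have hpos : Nat.find hex ≠ 0 := fun h0 => by
      have := Nat.find_spec hex
      rw [h0, ht.zero] at this
      linarith
    obtain ⟨k, hk⟩ := Nat.exists_eq_succ_of_ne_zero hpos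
    exact ⟨k, not_lt.1 (Nat.find_min hex (by omega)), by
      have := Nat.find_spec hex
      rwa [hk] at this⟩
  refine (hstep k s ⟨hk.1, hk.2.le⟩).trans
    ((mul_le_mul_of_nonneg_left (hnode k) (Real.exp_pos _).le).trans_eq ?_)
  rw [← mul_assoc, ← Real.exp_add]
  ring_nf

end Nominal

/-! ### From the exponential bound to robust asymptotic stability -/

theorem isAsymptoticallyStable_of_exp_bound {n : ℕ} {A A₁ P : Matrix (Fin n) (Fin n) ℝ}
    {τ : ℝ → ℝ} {α : ℝ} (hP : P.PosDef) (hα : 0 < α)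
    (h : ∀ x, IsSolution A A₁ τ x → ∀ s, 0 ≤ s →
      x s ⬝ᵥ P *ᵥ x s ≤ Real.exp (-α * s) * (x 0 ⬝ᵥ P *ᵥ x 0)) :
    IsAsymptoticallyStable A A₁ τ := by
  obtain ⟨e, he, hle⟩ := exists_pos_mul_form_le (fun _ => posDef_form_pos hP) 1
  have hcoord : ∀ (z : Fin n → ℝ) i, e * z i ^ 2 ≤ z ⬝ᵥ P *ᵥ z := fun z i => by
    refine le_trans (mul_le_mul_of_nonneg_left ?_ he.le) (hle z)
    rw [one_mulVec, pow_two]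
    exact Finset.single_le_sum (f := fun i => z i * z i) (fun j _ => mul_self_nonneg _)
      (Finset.mem_univ i)
  have hnn : ∀ z : Fin n → ℝ, 0 ≤ z ⬝ᵥ P *ᵥ z := fun z => by
    simpa using hP.posSemidef.dotProduct_mulVec_nonneg z
  refine ⟨fun ε hε => ?_, fun x hx => ?_⟩
  · have hcont : Tendsto (fun z : Fin n → ℝ => z ⬝ᵥ P *ᵥ z) (𝓝 0) (𝓝 0) := by
      have : Continuous fun z : Fin n → ℝ => z ⬝ᵥ P *ᵥ z := by fun_prop
      simpa using this.tendsto 0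
    obtain ⟨δ, hδ, hball⟩ := Metric.eventually_nhds_iff.1
      (hcont.eventually (gt_mem_nhds (by positivity : 0 < e * ε ^ 2)))
    refine ⟨δ, hδ, fun x hx hx0 s hs => (pi_norm_lt_iff hε).2 fun i => ?_⟩
    have h1 : x 0 ⬝ᵥ P *ᵥ x 0 < e * ε ^ 2 := hball (by simpa using hx0)
    have h2 : Real.exp (-α * s) ≤ 1 := Real.exp_le_one_iff.2 (by nlinarith)
    have h3 := (hcoord (x s) i).trans_lt (((h x hx s hs).trans
      (mul_le_of_le_one_left (hnn _) h2)).trans_lt h1)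
    exact abs_lt_of_sq_lt_sq (lt_of_mul_lt_mul_left h3 he.le) hε.le
  · refine tendsto_pi_nhds.2 fun i => ?_
    have hexp : Tendsto (fun s => e⁻¹ * (Real.exp (-α * s) * (x 0 ⬝ᵥ P *ᵥ x 0))) atTop (𝓝 0) := by
      have h1 : Tendsto (fun s => Real.exp (-α * s)) atTop (𝓝 0) :=
        Real.tendsto_exp_atBot.comp (tendsto_id.const_mul_atTop_of_neg (neg_lt_zero.2 hα))
      simpa using (h1.mul_const _).const_mul e⁻¹
    have hsq : Tendsto (fun s => x s i ^ 2) atTop (𝓝 0) := by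
      refine tendsto_of_tendsto_of_tendsto_of_le_of_le' tendsto_const_nhds hexp
        (Eventually.of_forall fun s => sq_nonneg _) ?_
      filter_upwards [eventually_ge_atTop 0] with s hs
      rw [le_inv_mul_iff₀ he]
      exact (hcoord (x s) i).trans (h x hx s hs)
    have habs := hsq.sqrt
    simp only [Real.sqrt_sq_eq_abs, Real.sqrt_zero] at habs
    exact (tendsto_zero_iff_abs_tendsto_zero _).2 habs

end SampledData

theorem theorem1 {n m p : ℕ} (Ts : ℝ)
    (A : Matrix (Fin n) (Fin n) ℝ) (B : Matrix (Fin n) (Fin m) ℝ)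
    (H : Matrix (Fin n) (Fin p) ℝ) (E : Matrix (Fin p) (Fin n) ℝ) (F : Matrix (Fin p) (Fin m) ℝ)
    (Q₁ Q₂ Q₃ Z₁ Z₂ Z₃ R : Matrix (Fin n) (Fin n) ℝ) (Y : Matrix (Fin m) (Fin n) ℝ) (ε₁ ε₂ : ℝ)
    (hQ₁ : Q₁.PosDef) (hR : R.PosDef) (hε₁ : 0 < ε₁) (hε₂ : 0 < ε₂)
    (h₁ : (-SampledData.firstLMI Ts A B H E F Q₁ Q₂ Q₃ Z₁ Z₂ Z₃ R Y ε₁).PosDef)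
    (h₂ : (SampledData.secondLMI B H F Q₁ Z₁ Z₂ Z₃ R Y ε₂).PosSemidef) :
    SampledData.IsRobustlyAsymptoticallyStable A B H E F (Y * Q₁⁻¹) Ts := by
  intro δ hδ t ht τ hτ
  have hQt : Q₁ᵀ = Q₁ := by simpa [IsHermitian] using hQ₁.isHermitian
  obtain ⟨α, hα, h⟩ := SampledData.exists_exp_bound hQ₁ hR
    (fun v hv => SampledData.W_form_neg hQt hε₁ h₁ hδ hv)
    (SampledData.symBlock_form_nonneg hε₂ h₂ hδ) ht hτ
  exact SampledData.isAsymptoticallyStable_of_exp_bound hQ₁.inv hα h
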